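/- Let $A$ be a (not necessarily unital) $C^*$-algebra. Let $\mathrm{T}(A)$ be the ordered cone (pointwise operations and order) of lower semicontinuous traces $\tau\colon A_+\to[0,\infty]$, i.e. norm-lower semicontinuous maps that are additive, satisfy $\tau(0)=0$, are homogeneous for positive reals, and satisfy $\tau(xx^*)=\tau(x^*x)$ for all $x\in A$. Equip $\mathrm{T}(A)$ with the topology in which $\tau_i\to\tau$ if and only if $\limsup_i\tau_i((a-\varepsilon)_+)\le\tau(a)\le\liminf_i\tau_i(a)$ for all $a\in A_+$ and $\varepsilon>0$. For a closed two-sided ideal $I$ of $A$, let $\tau_I\in\mathrm{T}(A)$ be the trace with value $0$ on $I_+$ and $\infty$ on $A_+\setminus I$, and let $$\mathrm{T}_I(A)=\{\tau\in\mathrm{T}(A)\mid \sup\{e\in\mathrm{T}(A)\mid 2e=e\le\tau\}=\tau_I\}.$$ Let $\mathrm{Ped}(I)$ be the smallest dense (not necessarily closed) two-sided ideal of the $C^*$-algebra $I$. A lower semicontinuous cone morphism $g\colon\mathrm{T}(A)\to[0,\infty]$ is said to have support ideal $I$ if the infimum of all idempotent lower semicontinuous cone morphisms $e\ge g$ on $\mathrm{T}(A)$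 is $f_I$, where $f_I(\tau)=0$ if $\tau\le\tau_I$ and $f_I(\tau)=\infty$ otherwise. For $a\in A_+$ let $\overline{a}\colon\mathrm{T}(A)\to[0,\infty]$, $\overline a(\tau)=\tau(a)$, and let $I=I_a$ be the closed two-sided ideal of $A$ generated by $a$. Assume that $a\in\mathrm{Ped}(I_a)$. Then: (1) The restriction $f:=\overline{a}|_{\mathrm{T}_{I}(A)}\colon\mathrm{T}_{I}(A)\to[0,\infty]$ is continuous, takes values in $[0,\infty)$, and $f^{-1}(\{0\})=\{\tau_{I}\}$. (2) Define $\tilde f\colon\mathrm{T}(A)\to[0,\infty]$ by $\tilde f(\tau)=f(\tau+\tau_{I})$ if $\tau+\tau_{I}\in\mathrm{T}_{I}(A)$, and $\tilde f(\tau)=\infty$ otherwise. Then $\tilde f=\overline{a}$. Moreover $\overline a$ is a continuous cone morphism on $\mathrm{T}(A)$ with support ideal $I$, and it is the only continuous cone morphism $\mathrm{T}(A)\to[0,\infty]$ with support ideal $I$ that extends $f$. -/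

import Mathlib

open scoped ENNReal NNReal Topology

noncomputable section

namespace TraceCone

universe u

set_option linter.unusedSectionVars false

variable {A : Type u} [NonUnitalCStarAlgebra A] [PartialOrder A] [StarOrderedRing A]

/-! ### Positive elements and cut-downs -/

/-- The positive cone `A₊` of a C*-algebra. -/
abbrev Pos (A : Type u) [NonUnitalCStarAlgebra A] [PartialOrder A] : Type u := {a : A // 0 ≤ a}

/-- The cut-down `(a - ε)₊`, i.e. the function `t ↦ max (t - ε) 0` applied to `a` by the
(non-unital) continuous functional calculus. It is used for `ε ≥ 0` only. -/
def cutDown (a : Pos A) (ε : ℝ) : Pos A :=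
  ⟨cfcₙ (fun t : ℝ => max (t - ε) 0) (a : A), cfcₙ_nonneg fun _ _ => le_max_right _ _⟩

/-! ### Lower semicontinuous traces -/

variable (A) in
/-- A lower semicontinuous trace on `A`: a map `τ : A₊ → [0,∞]` which is additive, compatible with
multiplication by positive reals, vanishes at `0`, satisfies `τ (x x*) = τ (x* x)`, and is lower
semicontinuous for the norm topology. -/
structure LscTrace where
  toFun : Pos A → ℝ≥0∞
  map_zero' : toFun 0 = 0
  map_add' : ∀ a b : Pos A, toFun (a + b) = toFun a + toFun b
  map_smul' : ∀ (r : ℝ≥0) (a : Pos A), 0 < r →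
    toFun ⟨(r : ℝ) • (a : A), smul_nonneg r.2 a.2⟩ = r * toFun a
  trace' : ∀ x : A, toFun ⟨x * star x, mul_star_self_nonneg x⟩ =
    toFun ⟨star x * x, star_mul_self_nonneg x⟩
  lsc' : LowerSemicontinuous toFun

namespace LscTrace

instance : CoeFun (LscTrace A) fun _ => Pos A → ℝ≥0∞ := ⟨LscTrace.toFun⟩

@[ext] theorem ext {σ τ : LscTrace A} (h : ∀ a, σ a = τ a) : σ = τ := by
  cases σ; cases τ; congr; funext a; exact h a

/-- The pointwise order on traces. -/
instance : PartialOrder (LscTrace A) where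
  le σ τ := ∀ a, σ a ≤ τ a
  le_refl _ _ := le_rfl
  le_trans _ _ _ h h' a := (h a).trans (h' a)
  le_antisymm _ _ h h' := ext fun a => le_antisymm (h a) (h' a)

instance : Zero (LscTrace A) where
  zero :=
    { toFun := fun _ => 0
      map_zero' := rfl
      map_add' := by simp
      map_smul' := by simp
      trace' := by simp
      lsc' := lowerSemicontinuous_const }

instance : Add (LscTrace A) where
  add σ τ :=
    { toFun := fun a => σ a + τ a
      map_zero' := by simp [σ.map_zero', τ.map_zero']
      map_add' := fun a b => by rw [σ.map_add', τ.map_add']; ring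
      map_smul' := fun r a hr => by rw [σ.map_smul' r a hr, τ.map_smul' r a hr]; ring
      trace' := fun x => by rw [σ.trace', τ.trace']
      lsc' := σ.lsc'.add τ.lsc' }

instance : SMul ℝ≥0 (LscTrace A) where
  smul r τ :=
    { toFun := fun a => r * τ a
      map_zero' := by simp [τ.map_zero']
      map_add' := fun a b => by rw [τ.map_add']; ring
      map_smul' := fun s a hs => by rw [τ.map_smul' s a hs]; ring
      trace' := fun x => by rw [τ.trace']
      lsc' := (ENNReal.continuous_const_mul ENNReal.coe_ne_top).comp_lowerSemicontinuous τ.lsc'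
        (fun _ _ h => mul_le_mul_right h _) }

theorem zero_apply (a : Pos A) : (0 : LscTrace A) a = 0 := rfl
theorem add_apply (σ τ : LscTrace A) (a : Pos A) : (σ + τ) a = σ a + τ a := rfl
theorem smul_apply (r : ℝ≥0) (τ : LscTrace A) (a : Pos A) : (r • τ) a = r * τ a := rfl

theorem mono (τ : LscTrace A) {a b : Pos A} (h : (a : A) ≤ b) : τ a ≤ τ b := by
  have : b = a + ⟨(b : A) - a, sub_nonneg.2 h⟩ := Subtype.ext (by simp)
  rw [this, τ.map_add']
  exact le_self_add

end LscTrace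

/-! ### The topology on the cone of traces -/

/-- The interval topology on the cone of lower semicontinuous traces. The theorem
`tendsto_interval_iff` below shows that it is the topology in which `τᵢ → τ` if and only if
`limsup τᵢ ((a - ε)₊) ≤ τ a ≤ liminf τᵢ a` for all `a ∈ A₊` and all `ε > 0`. -/
instance : TopologicalSpace (LscTrace A) :=
  TopologicalSpace.generateFrom
    ({U | ∃ (a : Pos A) (r : ℝ≥0∞), U = {τ : LscTrace A | r < τ a}} ∪
     {U | ∃ (a : Pos A) (ε : ℝ) (r : ℝ≥0∞),
        U = {τ : LscTrace A | ∃ δ : ℝ, 0 < δ ∧ δ < ε ∧ τ (cutDown a δ) < r}})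

theorem cutDown_le_cutDown (a : Pos A) {δ ε : ℝ} (h0 : 0 ≤ δ) (h : δ ≤ ε) :
    (cutDown a ε : A) ≤ cutDown a δ := by
  refine cfcₙ_mono (fun x _ => max_le_max (by linarith) le_rfl) ?_ ?_ ?_ ?_
  · fun_prop
  · fun_prop
  · simpa using h0.trans h
  · simpa using h0

theorem cutDown_le (a : Pos A) {ε : ℝ} (h0 : 0 ≤ ε) : (cutDown a ε : A) ≤ a := by
  conv_rhs => rw [← cfcₙ_id ℝ (a : A) (IsSelfAdjoint.of_nonneg a.2)]
  refine cfcₙ_mono (fun x hx => ?_) ?_ ?_ ?_ ?_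
  · exact max_le (by simpa using h0) (quasispectrum_nonneg_of_nonneg _ a.2 x hx)
  · fun_prop
  · fun_prop
  · simpa using h0
  · simp

theorem cutDown_cutDown (a : Pos A) {δ ε : ℝ} (h0 : 0 ≤ δ) (h1 : 0 ≤ ε) :
    cutDown (cutDown a δ) ε = cutDown a (δ + ε) := by
  apply Subtype.ext
  change cfcₙ (fun t : ℝ => max (t - ε) 0) (cfcₙ (fun t : ℝ => max (t - δ) 0) (a : A)) =
    cfcₙ (fun t : ℝ => max (t - (δ + ε)) 0) (a : A)
  rw [← cfcₙ_comp' (fun t : ℝ => max (t - ε) 0) (fun t : ℝ => max (t - δ) 0) (a : A)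
    (by fun_prop) (by simpa using h1) (by fun_prop) (by simpa using h0)
    (IsSelfAdjoint.of_nonneg a.2)]
  congr 1
  funext t
  grind

theorem tendsto_interval_iff {ι : Type*} {l : Filter ι} {σ : ι → LscTrace A} {τ : LscTrace A} :
    Filter.Tendsto σ l (𝓝 τ) ↔ ∀ (a : Pos A) (ε : ℝ), 0 < ε →
      Filter.limsup (fun i => σ i (cutDown a ε)) l ≤ τ a ∧
        τ a ≤ Filter.liminf (fun i => σ i a) l := by
  rw [TopologicalSpace.tendsto_nhds_generateFrom_iff]
  constructor
  · intro h a ε hε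
    constructor
    · refine le_of_forall_gt_imp_ge_of_dense fun r hr => ?_
      have := h _ (Or.inr ⟨a, ε, r, rfl⟩) ⟨ε / 2, by linarith, by linarith,
        (τ.mono (cutDown_le a (by linarith))).trans_lt hr⟩
      refine Filter.limsup_le_of_le (by isBoundedDefault) ?_
      filter_upwards [this] with i hi
      obtain ⟨δ, h0, h1, h2⟩ := hi
      exact ((σ i).mono (cutDown_le_cutDown a h0.le h1.le)).trans h2.le
    · refine le_of_forall_lt_imp_le_of_dense fun r hr => ?_
      have := h _ (Or.inl ⟨a, r, rfl⟩) hr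
      refine Filter.le_liminf_of_le (by isBoundedDefault) ?_
      filter_upwards [this] with i hi using le_of_lt hi
  · rintro h U (⟨a, r, rfl⟩ | ⟨a, ε, r, rfl⟩) hτ
    · exact Filter.eventually_lt_of_lt_liminf (lt_of_lt_of_le hτ (h a 1 one_pos).2)
    · obtain ⟨δ, h0, h1, h2⟩ := hτ
      have := (h (cutDown a δ) ((ε - δ) / 2) (by linarith)).1.trans_lt h2
      filter_upwards [Filter.eventually_lt_of_limsup_lt this] with i hi
      rw [cutDown_cutDown a h0.le (by linarith)] at hi
      exact ⟨δ + (ε - δ) / 2, by linarith, by linarith, hi⟩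

/-! ### Closed two-sided ideals and Pedersen ideals -/

variable (A) in
/-- A closed two-sided ideal of `A`. -/
structure ClosedIdeal extends Submodule ℂ A where
  mul_mem_left' : ∀ x y : A, y ∈ carrier → x * y ∈ carrier
  mul_mem_right' : ∀ x y : A, x ∈ carrier → x * y ∈ carrier
  isClosed' : IsClosed carrier

namespace ClosedIdeal

instance : Membership A (ClosedIdeal A) := ⟨fun I x => x ∈ I.toSubmodule⟩

theorem mul_mem_left (I : ClosedIdeal A) (x : A) {y : A} (hy : y ∈ I) : x * y ∈ I :=
  I.mul_mem_left' x y hy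

theorem mul_mem_right (I : ClosedIdeal A) {x : A} (y : A) (hx : x ∈ I) : x * y ∈ I :=
  I.mul_mem_right' x y hx

theorem zero_mem (I : ClosedIdeal A) : (0 : A) ∈ I := I.toSubmodule.zero_mem

theorem add_mem (I : ClosedIdeal A) {x y : A} (hx : x ∈ I) (hy : y ∈ I) : x + y ∈ I :=
  I.toSubmodule.add_mem hx hy

theorem smul_mem (I : ClosedIdeal A) (r : ℝ) {x : A} (hx : x ∈ I) : r • x ∈ I := by
  have := I.toSubmodule.smul_mem (r : ℂ) hx
  rwa [Complex.coe_smul] at this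

theorem isClosed (I : ClosedIdeal A) : IsClosed {x : A | x ∈ I} := I.isClosed'

/-- The closed two-sided ideal generated by `a`: the intersection of all closed two-sided ideals
that contain `a`. -/
def generatedBy (a : A) : ClosedIdeal A where
  toSubmodule := sInf {J | ∃ I : ClosedIdeal A, a ∈ I ∧ J = I.toSubmodule}
  mul_mem_left' x y hy := by
    simp only [AddSubsemigroup.mem_carrier, AddSubmonoid.mem_toSubsemigroup,
      Submodule.mem_toAddSubmonoid, Submodule.mem_sInf] at hy ⊢
    rintro J ⟨I, hI, rfl⟩
    exact I.mul_mem_left x (hy _ ⟨I, hI, rfl⟩)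
  mul_mem_right' x y hx := by
    simp only [AddSubsemigroup.mem_carrier, AddSubmonoid.mem_toSubsemigroup,
      Submodule.mem_toAddSubmonoid, Submodule.mem_sInf] at hx ⊢
    rintro J ⟨I, hI, rfl⟩
    exact I.mul_mem_right y (hx _ ⟨I, hI, rfl⟩)
  isClosed' := by
    change IsClosed ((sInf {J | ∃ I : ClosedIdeal A, a ∈ I ∧ J = I.toSubmodule} :
      Submodule ℂ A) : Set A)
    rw [Submodule.coe_sInf]
    refine isClosed_biInter ?_
    rintro J ⟨I, -, rfl⟩
    exact I.isClosed'

/-- The Pedersen ideal `Ped(I)` of a closed two-sided ideal `I`, regarded as a C*-algebra: the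
smallest dense (not necessarily closed) two-sided ideal of `I`, i.e. the intersection of all linear
subspaces `J` of `I` that are dense in `I` and stable under multiplication by elements of `I` from
either side. -/
def pedersen (I : ClosedIdeal A) : Submodule ℂ A :=
  sInf {J | J ≤ I.toSubmodule ∧ (I.toSubmodule : Set A) ⊆ closure (J : Set A) ∧
    ∀ x ∈ I, ∀ y ∈ J, x * y ∈ J ∧ y * x ∈ J}

/-- If `b ∈ I` is positive and `x x* ≤ b`, then `x ∈ I`. -/
theorem mem_of_mul_star_self_le (I : ClosedIdeal A) {b x : A} (hb : b ∈ I)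
    (h : x * star x ≤ b) : x ∈ I := by
  have hb0 : 0 ≤ b := (mul_star_self_nonneg x).trans h
  have hsa : IsSelfAdjoint b := .of_nonneg hb0
  have key : ∀ ε : ℝ, 0 < ε → ∃ u ∈ I, ‖x - u * x‖ * ‖x - u * x‖ ≤ ε := by
    intro ε hε
    have hcont : Continuous fun t : ℝ => t / (t ^ 2 + ε ^ 2) :=
      continuous_id.div (by fun_prop) fun t => by positivity
    set k := cfcₙ (fun t : ℝ => t / (t ^ 2 + ε ^ 2)) b with hk
    have hu : b * k = cfcₙ (fun t : ℝ => t * (t / (t ^ 2 + ε ^ 2))) b := by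
      rw [cfcₙ_mul (fun t : ℝ => t) _ b (by fun_prop) (by simp) hcont.continuousOn (by simp),
        cfcₙ_id' ℝ b hsa]
    have husa : star (b * k) = b * k := by
      rw [hu]; exact (cfcₙ_predicate _ b : IsSelfAdjoint _).star_eq
    refine ⟨b * k, I.mul_mem_right k hb, ?_⟩
    set u := b * k with hudef
    have conj : ∀ y : A, (y - u * y) * star (y - u * y) =
        y * star y - u * (y * star y) - y * star y * u + u * (y * star y) * u := by
      intro y
      rw [star_sub, star_mul, husa]
      noncomm_ring
    have hle : (x - u * x) * star (x - u * x) ≤ b - u * b - b * u + u * b * u := by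
      rw [conj]
      obtain ⟨y, hy⟩ := CStarAlgebra.nonneg_iff_eq_mul_star_self.1 (sub_nonneg.2 h)
      have := mul_star_self_nonneg (y - u * y)
      rw [conj, ← hy] at this
      rw [← sub_nonneg]
      convert this using 1
      noncomm_ring
    have hcfc : b - u * b - b * u + u * b * u =
        cfcₙ (fun t : ℝ => t - t * (t / (t ^ 2 + ε ^ 2)) * t - t * (t * (t / (t ^ 2 + ε ^ 2)))
          + t * (t / (t ^ 2 + ε ^ 2)) * t * (t * (t / (t ^ 2 + ε ^ 2)))) b := by
      have hb' : b = cfcₙ (fun t : ℝ => t) b := (cfcₙ_id' ℝ b hsa).symm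
      rw [hu]
      conv_lhs => rw [hb']
      simp only [cfcₙ_id' ℝ b hsa]
      rw [cfcₙ_add (fun t : ℝ => t - t * (t / (t ^ 2 + ε ^ 2)) * t
          - t * (t * (t / (t ^ 2 + ε ^ 2)))) _ b (by fun_prop) (by simp) (by fun_prop) (by simp),
        cfcₙ_sub (fun t : ℝ => t - t * (t / (t ^ 2 + ε ^ 2)) * t) _ b
          (by fun_prop) (by simp) (by fun_prop) (by simp),
        cfcₙ_sub (fun t : ℝ => t) _ b (by fun_prop) (by simp) (by fun_prop) (by simp),
        cfcₙ_mul (fun t : ℝ => t * (t / (t ^ 2 + ε ^ 2)) * t) _ b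
          (by fun_prop) (by simp) (by fun_prop) (by simp),
        cfcₙ_mul (fun t : ℝ => t * (t / (t ^ 2 + ε ^ 2))) (fun t : ℝ => t) b
          (by fun_prop) (by simp) (by fun_prop) (by simp),
        cfcₙ_mul (fun t : ℝ => t) (fun t : ℝ => t * (t / (t ^ 2 + ε ^ 2))) b
          (by fun_prop) (by simp) (by fun_prop) (by simp),
        cfcₙ_id' ℝ b hsa]
    rw [← CStarRing.norm_self_mul_star]
    refine (CStarAlgebra.norm_le_norm_of_nonneg_of_le (mul_star_self_nonneg _) hle).trans ?_
    rw [hcfc]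
    refine norm_cfcₙ_le fun t ht => ?_
    have ht0 : 0 ≤ t := quasispectrum_nonneg_of_nonneg _ hb0 t ht
    have : t - t * (t / (t ^ 2 + ε ^ 2)) * t - t * (t * (t / (t ^ 2 + ε ^ 2)))
          + t * (t / (t ^ 2 + ε ^ 2)) * t * (t * (t / (t ^ 2 + ε ^ 2)))
        = t * ε ^ 4 / (t ^ 2 + ε ^ 2) ^ 2 := by
      field_simp; ring
    rw [this, Real.norm_of_nonneg (by positivity), div_le_iff₀ (by positivity)]
    have h1 : t * ε ≤ t ^ 2 + ε ^ 2 := by nlinarith [sq_nonneg (t - ε)]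
    have h2 : ε ^ 2 ≤ t ^ 2 + ε ^ 2 := by nlinarith
    calc t * ε ^ 4 = ε * ((t * ε) * ε ^ 2) := by ring
      _ ≤ ε * ((t ^ 2 + ε ^ 2) * (t ^ 2 + ε ^ 2)) := by gcongr
      _ = _ := by ring
  have : x ∈ closure {y : A | y ∈ I} := by
    rw [Metric.mem_closure_iff]
    intro δ hδ
    obtain ⟨u, hu, hux⟩ := key ((δ / 2) ^ 2) (by positivity)
    refine ⟨u * x, I.mul_mem_right x hu, ?_⟩
    rw [dist_eq_norm]
    have := abs_le_of_sq_le_sq' (by simpa [sq] using hux) (by positivity : 0 ≤ δ / 2)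
    linarith [this.2]
  rwa [I.isClosed.closure_eq] at this

/-- Closed two-sided ideals are hereditary. -/
theorem mem_of_le (I : ClosedIdeal A) {a b : A} (ha : 0 ≤ a) (hb : b ∈ I) (h : a ≤ b) :
    a ∈ I := by
  obtain ⟨x, rfl⟩ := CStarAlgebra.nonneg_iff_eq_mul_star_self.1 ha
  exact I.mul_mem_right _ (I.mem_of_mul_star_self_le hb h)

end ClosedIdeal

/-! ### The traces attached to ideals -/

open Classical in
/-- The trace `τ_I`, with value `0` on `I` and `∞` elsewhere. -/
def idealTrace (I : ClosedIdeal A) : LscTrace A where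
  toFun a := if (a : A) ∈ I then 0 else ⊤
  map_zero' := if_pos I.zero_mem
  map_add' a b := by
    by_cases ha : (a : A) ∈ I <;> by_cases hb : (b : A) ∈ I
    · have : ((a + b : Pos A) : A) ∈ I := I.add_mem ha hb
      simp only [if_pos this, if_pos ha, if_pos hb, add_zero]
    · have : ((a + b : Pos A) : A) ∉ I := fun h =>
        hb (I.mem_of_le b.2 h (le_add_of_nonneg_left a.2))
      simp only [if_neg this, if_neg hb, add_top]
    · have : ((a + b : Pos A) : A) ∉ I := fun h =>
        ha (I.mem_of_le a.2 h (le_add_of_nonneg_right b.2))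
      simp only [if_neg this, if_neg ha, top_add]
    · have : ((a + b : Pos A) : A) ∉ I := fun h =>
        ha (I.mem_of_le a.2 h (le_add_of_nonneg_right b.2))
      simp only [if_neg this, if_neg ha, top_add]
  map_smul' r a hr := by
    by_cases ha : (a : A) ∈ I
    · simp only [if_pos ha, if_pos (I.smul_mem (r : ℝ) ha), mul_zero]
    · have : (r : ℝ) • (a : A) ∉ I := fun h => ha (by
        have := I.smul_mem (r : ℝ)⁻¹ h
        rwa [smul_smul, inv_mul_cancel₀ (by exact_mod_cast hr.ne'), one_smul] at this)
      simp only [if_neg ha, if_neg this]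
      rw [ENNReal.mul_top (by exact_mod_cast hr.ne')]
  trace' x := by
    have h1 : x * star x ∈ I ↔ x ∈ I :=
      ⟨fun h => I.mem_of_mul_star_self_le h le_rfl, fun h => I.mul_mem_right _ h⟩
    have h2 : star x * x ∈ I ↔ x ∈ I := by
      refine ⟨fun h => ?_, fun h => I.mul_mem_left _ h⟩
      have : star x ∈ I := I.mem_of_mul_star_self_le h (by rw [star_star])
      exact h1.1 (I.mul_mem_left _ this)
    simp only [h1, h2]
  lsc' := by
    intro a r hr
    dsimp only at hr
    split_ifs at hr with ha
    · exact absurd hr not_lt_zero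
    · have hopen : IsOpen {b : Pos A | (b : A) ∉ I} :=
        (I.isClosed.preimage continuous_subtype_val).isOpen_compl
      filter_upwards [hopen.mem_nhds ha] with b hb
      have hb' : (b : A) ∉ I := hb
      simpa only [if_neg hb'] using hr

theorem idealTrace_of_mem {I : ClosedIdeal A} {a : Pos A} (h : (a : A) ∈ I) :
    idealTrace I a = 0 := if_pos h

theorem idealTrace_of_notMem {I : ClosedIdeal A} {a : Pos A} (h : (a : A) ∉ I) :
    idealTrace I a = ⊤ := if_neg h

theorem idealTrace_add_self (I : ClosedIdeal A) : idealTrace I + idealTrace I = idealTrace I := by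
  ext a
  rw [LscTrace.add_apply]
  by_cases h : (a : A) ∈ I
  · simp [idealTrace_of_mem h]
  · simp [idealTrace_of_notMem h]

/-- The subcone `T_I(A)` of all traces `τ` with support idempotent `τ_I`, the support idempotent
of `τ` being the supremum in `T(A)` of all idempotents `e ≤ τ`. -/
def supportCone (I : ClosedIdeal A) : Set (LscTrace A) :=
  {τ | IsLUB {e : LscTrace A | e + e = e ∧ e ≤ τ} (idealTrace I)}

theorem idealTrace_mem_supportCone (I : ClosedIdeal A) : idealTrace I ∈ supportCone I :=
  ⟨fun _ he => he.2, fun _ h => h ⟨idealTrace_add_self I, le_rfl⟩⟩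

/-! ### Lower semicontinuous and continuous functionals on the cone of traces -/

variable (A) in
/-- `Lsc_C(T(A))`: the lower semicontinuous cone morphisms `T(A) → [0,∞]`. -/
structure LscFunctional where
  toFun : LscTrace A → ℝ≥0∞
  map_zero' : toFun 0 = 0
  map_add' : ∀ σ τ : LscTrace A, toFun (σ + τ) = toFun σ + toFun τ
  map_smul' : ∀ (r : ℝ≥0) (τ : LscTrace A), 0 < r → toFun (r • τ) = r * toFun τ
  lsc' : LowerSemicontinuous toFun

namespace LscFunctional

instance : CoeFun (LscFunctional A) fun _ => LscTrace A → ℝ≥0∞ := ⟨LscFunctional.toFun⟩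

@[ext] theorem ext {f g : LscFunctional A} (h : ∀ τ, f τ = g τ) : f = g := by
  cases f; cases g; congr; funext τ; exact h τ

/-- The pointwise order on functionals. -/
instance : PartialOrder (LscFunctional A) where
  le f g := ∀ τ, f τ ≤ g τ
  le_refl _ _ := le_rfl
  le_trans _ _ _ h h' τ := (h τ).trans (h' τ)
  le_antisymm _ _ h h' := ext fun τ => le_antisymm (h τ) (h' τ)

end LscFunctional

theorem isOpen_lt_apply (a : Pos A) (r : ℝ≥0∞) : IsOpen {τ : LscTrace A | r < τ a} :=
  TopologicalSpace.isOpen_generateFrom_of_mem (Or.inl ⟨a, r, rfl⟩)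

/-- The evaluation functional `ā : T(A) → [0,∞]`, `τ ↦ τ a`. -/
def evalFunctional (a : Pos A) : LscFunctional A where
  toFun τ := τ a
  map_zero' := rfl
  map_add' _ _ := rfl
  map_smul' _ _ _ := rfl
  lsc' := lowerSemicontinuous_iff_isOpen_preimage.2 fun r => isOpen_lt_apply a r

theorem le_idealTrace_iff {I : ClosedIdeal A} {τ : LscTrace A} :
    τ ≤ idealTrace I ↔ ∀ a : Pos A, (a : A) ∈ I → τ a = 0 := by
  refine ⟨fun h a ha => ?_, fun h a => ?_⟩
  · have := h a
    rwa [idealTrace_of_mem ha, nonpos_iff_eq_zero] at this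
  · by_cases ha : (a : A) ∈ I
    · rw [h a ha]; exact zero_le
    · rw [idealTrace_of_notMem ha]; exact le_top

open Classical in
/-- The idempotent functional `f_I`, with value `0` at the traces `τ ≤ τ_I` and `∞` elsewhere. -/
def idealFunctional (I : ClosedIdeal A) : LscFunctional A where
  toFun τ := if τ ≤ idealTrace I then 0 else ⊤
  map_zero' := if_pos fun _ => zero_le
  map_add' σ τ := by
    have : σ + τ ≤ idealTrace I ↔ σ ≤ idealTrace I ∧ τ ≤ idealTrace I := by
      simp only [le_idealTrace_iff, LscTrace.add_apply, add_eq_zero]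
      exact ⟨fun h => ⟨fun a ha => (h a ha).1, fun a ha => (h a ha).2⟩,
        fun h a ha => ⟨h.1 a ha, h.2 a ha⟩⟩
    by_cases h1 : σ ≤ idealTrace I <;> by_cases h2 : τ ≤ idealTrace I <;> simp [this, h1, h2]
  map_smul' r τ hr := by
    have : r • τ ≤ idealTrace I ↔ τ ≤ idealTrace I := by
      simp only [le_idealTrace_iff, LscTrace.smul_apply, mul_eq_zero, ENNReal.coe_eq_zero, hr.ne',
        false_or]
    by_cases h : τ ≤ idealTrace I
    · simp [this, h]
    · simp only [this, if_neg h]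
      rw [ENNReal.mul_top (by exact_mod_cast hr.ne')]
  lsc' := by
    intro τ r hr
    dsimp only at hr
    split_ifs at hr with h
    · exact absurd hr not_lt_zero
    · simp only [le_idealTrace_iff, not_forall] at h
      obtain ⟨a, ha, h0⟩ := h
      filter_upwards [(isOpen_lt_apply a 0).mem_nhds (pos_iff_ne_zero.2 h0)] with σ hσ
      have : ¬ σ ≤ idealTrace I := fun h' => (ne_of_gt hσ) (le_idealTrace_iff.1 h' a ha)
      simpa only [if_neg this] using hr

/-- `g` has support ideal `I`: the infimum in `Lsc_C(T(A))` of all idempotents `e ≥ g` is `f_I`. -/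
def LscFunctional.HasSupportIdeal (g : LscFunctional A) (I : ClosedIdeal A) : Prop :=
  IsGLB {e : LscFunctional A | (∀ τ, e τ + e τ = e τ) ∧ g ≤ e} (idealFunctional I)

open Classical in
/-- The extension `f̃` to `T(A)` of a function `f` on `T_I(A)`: it sends `τ` to `f (τ + τ_I)` if
`τ + τ_I` belongs to `T_I(A)`, and to `∞` otherwise. -/
def extend (I : ClosedIdeal A) (f : supportCone I → ℝ≥0∞) (τ : LscTrace A) : ℝ≥0∞ :=
  if h : τ + idealTrace I ∈ supportCone I then f ⟨τ + idealTrace I, h⟩ else ⊤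

end TraceCone

end

open TraceCone

noncomputable section

namespace TraceCone

universe u

set_option linter.unusedSectionVars false

variable {A : Type u} [NonUnitalCStarAlgebra A] [PartialOrder A] [StarOrderedRing A]

/-! ### Traces of squares -/

/-! Everything rests on one estimate, `exists_apply_le_cutDown`: if `a ∈ Ped(I_a)`, there are `C`
and `ε > 0` with `σ(a) ≤ (1 + Cδ) σ((a - δ)₊)` for all `0 ≤ δ ≤ ε` and all traces `σ`. The topology
makes `ā` lower semicontinuous and bounds the traces of cut-downs from above near a given trace, so
the estimate gives continuity of `ā`.

To prove it, write `a = (a - δ)₊ + min(a, δ)`. The products `x* y` with `x* x` and `y* y` dominated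
by the cut-downs of `a` (`IsDominated`) span a dense two-sided ideal of `I_a`. This ideal contains
`Ped(I_a)`, so `a ≤ s` for some dominated `s`. Since `min(a, δ) ≤ s`, it is a limit of compressions
`x* s x` of norm at most `δ` (`exists_compress_near`), and domination with lower semicontinuity
gives `σ(min(a, δ)) ≤ Cδ σ((a - ε)₊)`.

The support idempotent of `τ` is `τ_J`, where `J` is the closed ideal on which `τ` is densely
finite; thus `τ ∈ T_I(A)` iff `J = I`. Cut-downs of elements of `J₊` have finite trace, so by the
estimate `τ(a) < ∞` iff `a ∈ J`.

For uniqueness, let `g` be a continuous extension with support ideal `I`. If `τ(a) < ∞`, then `τ +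
τ_I ∈ T_I(A)`, and `g(τ_I) = 0` gives `g(τ) = τ(a)`. If `τ(a) = ∞`, then `a ∉ J`. The multiples
`τ/n` converge to `τ_J`, so `g(τ) < ∞` would give `g(τ_J) = 0`, hence `τ_J ≤ τ_I` and `a ∈ J`, a
contradiction. -/

/-- The positive element `x* x`. -/
def sq (x : A) : Pos A := ⟨star x * x, star_mul_self_nonneg x⟩

theorem continuous_sq : Continuous (sq : A → Pos A) :=
  (continuous_star.mul continuous_id).subtype_mk _

theorem exists_sq_eq (b : Pos A) : ∃ x : A, IsSelfAdjoint x ∧ sq x = b := by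
  refine ⟨CFC.sqrt (b : A), .of_nonneg (CFC.sqrt_nonneg _), Subtype.ext ?_⟩
  change star (CFC.sqrt (b : A)) * CFC.sqrt (b : A) = b
  rw [(IsSelfAdjoint.of_nonneg (CFC.sqrt_nonneg (b : A))).star_eq]
  exact CFC.sqrt_mul_sqrt_self _ b.2

namespace LscTrace

theorem map_nnreal_smul (τ : LscTrace A) (r : ℝ≥0) (a : Pos A) :
    τ ⟨(r : ℝ) • (a : A), smul_nonneg r.2 a.2⟩ = r * τ a := by
  rcases eq_or_ne r 0 with rfl | hr
  · have : (⟨((0 : ℝ≥0) : ℝ) • (a : A), smul_nonneg (0 : ℝ≥0).2 a.2⟩ : Pos A) = 0 :=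
      Subtype.ext (by simp)
    rw [this, τ.map_zero']
    simp
  · exact τ.map_smul' r a (pos_iff_ne_zero.2 hr)

theorem apply_le_of_le_smul (τ : LscTrace A) {a b : Pos A} (r : ℝ≥0)
    (h : (a : A) ≤ (r : ℝ) • (b : A)) : τ a ≤ r * τ b := by
  rw [← τ.map_nnreal_smul]
  exact τ.mono h

theorem sq_star (τ : LscTrace A) (x : A) : τ (sq (star x)) = τ (sq x) := by
  have := τ.trace' x
  rw [sq, sq, ← this]
  congr 2
  rw [star_star]

theorem sq_mul_left_le (τ : LscTrace A) (z x : A) :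
    τ (sq (z * x)) ≤ (‖z‖₊ ^ 2 : ℝ≥0) * τ (sq x) := by
  refine τ.apply_le_of_le_smul _ ?_
  have := CStarAlgebra.star_left_conjugate_le_norm_smul (a := x) (b := star z * z)
    (.star_mul_self z)
  rw [CStarRing.norm_star_mul_self] at this
  change star (z * x) * (z * x) ≤ _
  rw [star_mul, show star x * star z * (z * x) = star x * (star z * z) * x by noncomm_ring]
  simpa [pow_two, sq] using this

/-- The trace identity exchanges `x z` with its adjoint, which turns right multiplication into left
multiplication. -/
theorem sq_mul_right_le (τ : LscTrace A) (x z : A) :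
    τ (sq (x * z)) ≤ (‖z‖₊ ^ 2 : ℝ≥0) * τ (sq x) := by
  rw [← τ.sq_star, ← τ.sq_star x, star_mul, ← nnnorm_star z]
  exact τ.sq_mul_left_le _ _

theorem sq_add_le (τ : LscTrace A) (x y : A) :
    τ (sq (x + y)) ≤ 2 * τ (sq x) + 2 * τ (sq y) := by
  have h : τ (sq (x + y)) ≤ (2 : ℝ≥0) * τ (sq x + sq y) := by
    refine τ.apply_le_of_le_smul _ ?_
    change star (x + y) * (x + y) ≤ ((2 : ℝ≥0) : ℝ) • (star x * x + star y * y)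
    have := star_mul_self_nonneg (x - y)
    rw [← sub_nonneg]
    convert this using 1
    rw [NNReal.coe_ofNat, two_smul, star_add, star_sub]
    noncomm_ring
  rw [τ.map_add', mul_add] at h
  exact_mod_cast h

theorem sq_smul (τ : LscTrace A) (c : ℂ) (x : A) :
    τ (sq (c • x)) = (‖c‖₊ ^ 2 : ℝ≥0) * τ (sq x) := by
  rw [← τ.map_nnreal_smul]
  congr 1
  apply Subtype.ext
  change star (c • x) * (c • x) = ((‖c‖₊ ^ 2 : ℝ≥0) : ℝ) • (star x * x)
  rw [star_smul, smul_mul_smul_comm, ← Complex.coe_smul]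
  congr 1
  rw [Complex.star_def, Complex.conj_mul']
  simp

theorem isClosed_sq_le (τ : LscTrace A) (r : ℝ≥0∞) : IsClosed {x : A | τ (sq x) ≤ r} :=
  (τ.lsc'.isClosed_preimage r).preimage continuous_sq

/-- The closed ideal of all `x` with `τ (x* x) = 0`. -/
def kernel (τ : LscTrace A) : ClosedIdeal A where
  carrier := {x | τ (sq x) ≤ 0}
  zero_mem' := by
    have : sq (0 : A) = 0 := Subtype.ext (by simp [sq])
    simp [this, τ.map_zero']
  add_mem' {x y} hx hy := by
    simp only [Set.mem_ofPred_eq, nonpos_iff_eq_zero] at hx hy ⊢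
    simpa [hx, hy] using τ.sq_add_le x y
  smul_mem' c x hx := by
    simp only [Set.mem_ofPred_eq, nonpos_iff_eq_zero] at hx ⊢
    simp [τ.sq_smul, hx]
  mul_mem_left' x y hy := by
    change τ (sq y) ≤ 0 at hy
    change τ (sq (x * y)) ≤ 0
    rw [nonpos_iff_eq_zero] at hy ⊢
    simpa [hy] using τ.sq_mul_left_le x y
  mul_mem_right' x y hx := by
    change τ (sq x) ≤ 0 at hx
    change τ (sq (x * y)) ≤ 0
    rw [nonpos_iff_eq_zero] at hx ⊢
    simpa [hx] using τ.sq_mul_right_le x y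
  isClosed' := τ.isClosed_sq_le 0

/-- The linear subspace of all `x` with `τ (x* x) < ∞`. -/
def squareSummable (τ : LscTrace A) : Submodule ℂ A where
  carrier := {x | τ (sq x) < ⊤}
  zero_mem' := by
    have : sq (0 : A) = 0 := Subtype.ext (by simp [sq])
    simp [this, τ.map_zero']
  add_mem' {x y} hx hy := (τ.sq_add_le x y).trans_lt
    (ENNReal.add_lt_top.2 ⟨ENNReal.mul_lt_top (by simp) hx, ENNReal.mul_lt_top (by simp) hy⟩)
  smul_mem' c x hx := by
    change τ (sq (c • x)) < ⊤
    rw [τ.sq_smul]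
    exact ENNReal.mul_lt_top ENNReal.coe_lt_top hx

/-- The closed ideal on which `τ` is densely finite. -/
def finiteIdeal (τ : LscTrace A) : ClosedIdeal A where
  toSubmodule := τ.squareSummable.topologicalClosure
  mul_mem_left' x _ hy := map_mem_closure (continuous_const_mul x) hy fun z hz =>
    (τ.sq_mul_left_le x z).trans_lt (ENNReal.mul_lt_top ENNReal.coe_lt_top hz)
  mul_mem_right' _ y hx := map_mem_closure (f := fun z => z * y) (continuous_mul_const y) hx fun z hz =>
    (τ.sq_mul_right_le z y).trans_lt (ENNReal.mul_lt_top ENNReal.coe_lt_top hz)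
  isClosed' := τ.squareSummable.isClosed_topologicalClosure

end LscTrace

/-! ### Closed ideals and the order on traces -/

namespace ClosedIdeal

theorem mem_of_sq_mem (I : ClosedIdeal A) {x : A} (h : (sq x : A) ∈ I) : x ∈ I := by
  have h1 : star x ∈ I := I.mem_of_mul_star_self_le (b := star x * x) h (by rw [star_star])
  exact I.mem_of_mul_star_self_le (I.mul_mem_left x h1) le_rfl

theorem sq_mem_iff (I : ClosedIdeal A) {x : A} : (sq x : A) ∈ I ↔ x ∈ I :=
  ⟨I.mem_of_sq_mem, fun h => I.mul_mem_left _ h⟩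

theorem mem_generatedBy (a : A) : a ∈ generatedBy a := by
  change a ∈ (sInf _ : Submodule ℂ A)
  rw [Submodule.mem_sInf]
  rintro J ⟨I, hI, rfl⟩
  exact hI

theorem generatedBy_le {a : A} {I : ClosedIdeal A} (h : a ∈ I) {x : A}
    (hx : x ∈ generatedBy a) : x ∈ I := by
  change x ∈ (sInf _ : Submodule ℂ A) at hx
  exact Submodule.mem_sInf.1 hx _ ⟨I, h, rfl⟩

/-- A closed ideal contains `x` exactly when it contains `x* x`, so its positive part determines it.
-/
theorem ext_of_forall_nonneg {I J : ClosedIdeal A}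
    (h : ∀ b : Pos A, (b : A) ∈ I ↔ (b : A) ∈ J) : I = J := by
  have : I.toSubmodule = J.toSubmodule := by
    ext x
    change x ∈ I ↔ x ∈ J
    rw [← I.sq_mem_iff, ← J.sq_mem_iff, h]
  cases I; cases J; congr

end ClosedIdeal

theorem idealTrace_le_idealTrace_iff {I J : ClosedIdeal A} :
    idealTrace I ≤ idealTrace J ↔ ∀ b : Pos A, (b : A) ∈ J → (b : A) ∈ I := by
  rw [le_idealTrace_iff]
  refine forall₂_congr fun b _ => ?_
  by_cases hb : (b : A) ∈ I
  · simp [idealTrace_of_mem hb, hb]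
  · simp [idealTrace_of_notMem hb, hb]

theorem idealTrace_injective : Function.Injective (idealTrace : ClosedIdeal A → LscTrace A) :=
  fun _ _ h => ClosedIdeal.ext_of_forall_nonneg fun b =>
    ⟨idealTrace_le_idealTrace_iff.1 h.ge b, idealTrace_le_idealTrace_iff.1 h.le b⟩

namespace LscTrace

theorem mem_kernel_iff (τ : LscTrace A) (b : Pos A) : (b : A) ∈ τ.kernel ↔ τ b = 0 := by
  obtain ⟨x, -, rfl⟩ := exists_sq_eq b
  rw [ClosedIdeal.sq_mem_iff]
  exact nonpos_iff_eq_zero (a := τ (sq x))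

/-- The kernel of `τ` is a closed ideal, so it contains `I_a` as soon as it contains `a`. -/
theorem le_idealTrace_generatedBy_iff {τ : LscTrace A} {a : Pos A} :
    τ ≤ idealTrace (ClosedIdeal.generatedBy (a : A)) ↔ τ a = 0 := by
  rw [le_idealTrace_iff]
  refine ⟨fun h => h a (ClosedIdeal.mem_generatedBy _), fun h b hb => ?_⟩
  exact (τ.mem_kernel_iff b).1 (ClosedIdeal.generatedBy_le ((τ.mem_kernel_iff a).2 h) hb)

theorem mem_finiteIdeal_of_lt_top {τ : LscTrace A} {b : Pos A} (h : τ b < ⊤) :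
    (b : A) ∈ τ.finiteIdeal := by
  obtain ⟨x, -, rfl⟩ := exists_sq_eq b
  exact τ.finiteIdeal.mul_mem_left _ (subset_closure h)

theorem idealTrace_finiteIdeal_le (τ : LscTrace A) : idealTrace τ.finiteIdeal ≤ τ := by
  intro b
  by_cases h : τ b < ⊤
  · rw [idealTrace_of_mem (mem_finiteIdeal_of_lt_top h)]; exact zero_le
  · rw [not_lt_top_iff.1 h]; exact le_top

theorem eq_zero_of_add_self_eq {x : ℝ≥0∞} (h : x + x = x) (hx : x < ⊤) : x = 0 := by
  have : x + x = x + 0 := by rw [h, add_zero]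
  exact (ENNReal.add_right_inj hx.ne).1 this

/-- The idempotent `τ_J`, for `J` the ideal on which `τ` is densely finite, is the support
idempotent of `τ`. -/
theorem isLUB_idealTrace_finiteIdeal (τ : LscTrace A) :
    IsLUB {e : LscTrace A | e + e = e ∧ e ≤ τ} (idealTrace τ.finiteIdeal) := by
  refine ⟨?_, fun f hf => hf ⟨idealTrace_add_self _, τ.idealTrace_finiteIdeal_le⟩⟩
  rintro e ⟨he, heτ⟩
  rw [le_idealTrace_iff]
  intro b hb
  rw [← e.mem_kernel_iff]
  -- An idempotent takes only the values `0` and `∞`, so `e ≤ τ` vanishes wherever `τ` is finite;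
  -- closedness of its kernel passes this to `J`.
  refine closure_minimal (t := {x | x ∈ e.kernel}) (fun x hx => ?_) e.kernel.isClosed hb
  have : e (sq x) + e (sq x) = e (sq x) := congrArg (fun f : LscTrace A => f (sq x)) he
  exact (eq_zero_of_add_self_eq this ((heτ _).trans_lt hx)).le

theorem mem_supportCone_iff {τ : LscTrace A} {I : ClosedIdeal A} :
    τ ∈ supportCone I ↔ I = τ.finiteIdeal :=
  ⟨fun h => idealTrace_injective (h.unique τ.isLUB_idealTrace_finiteIdeal),
    fun h => h ▸ τ.isLUB_idealTrace_finiteIdeal⟩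

end LscTrace

/-! ### Functional calculus estimates -/

theorem cfcₙ_conj_self {b : A} (hb : IsSelfAdjoint b) {f : ℝ → ℝ} (hf : Continuous f)
    (h0 : f 0 = 0) : cfcₙ f b * b * cfcₙ f b = cfcₙ (fun t => f t * t * f t) b := by
  have hf' := hf.continuousOn (s := quasispectrum ℝ b)
  rw [cfcₙ_mul (fun t : ℝ => f t * t) f b (by fun_prop) (by simp) hf' h0,
    cfcₙ_mul f (fun t : ℝ => t) b hf' h0 (by fun_prop) (by simp), cfcₙ_id' ℝ b hb]

theorem isSelfAdjoint_cfcₙ (f : ℝ → ℝ) (b : A) : IsSelfAdjoint (cfcₙ f b) := cfcₙ_predicate _ b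

theorem sq_of_isSelfAdjoint {x : A} (hx : IsSelfAdjoint x) : (sq x : A) = x * x := by
  change star x * x = x * x
  rw [hx.star_eq]

theorem sq_cfcₙ {f : ℝ → ℝ} {b : A} (hf : Continuous f) (h0 : f 0 = 0) :
    (sq (cfcₙ f b) : A) = cfcₙ (fun t => f t * f t) b := by
  rw [sq_of_isSelfAdjoint (isSelfAdjoint_cfcₙ f b),
    cfcₙ_mul f f b hf.continuousOn h0 hf.continuousOn h0]

theorem norm_sub_cutDown_le (a : Pos A) {ε : ℝ} (hε : 0 ≤ ε) :
    ‖(a : A) - cutDown a ε‖ ≤ ε := by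
  have : (a : A) - cutDown a ε = cfcₙ (fun t : ℝ => t - max (t - ε) 0) (a : A) := by
    rw [cfcₙ_sub (fun t : ℝ => t) _ (a : A) (by fun_prop) (by simp) (by fun_prop)
      (by simpa using hε), cfcₙ_id' ℝ (a : A) (.of_nonneg a.2)]
    rfl
  rw [this]
  refine norm_cfcₙ_le fun t ht => ?_
  have ht0 : 0 ≤ t := quasispectrum_nonneg_of_nonneg _ a.2 t ht
  rw [Real.norm_eq_abs, abs_le]
  grind

/-- The element `min(a, δ)`. -/
def truncate (a : Pos A) (δ : ℝ) (hδ : 0 ≤ δ) : Pos A :=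
  ⟨cfcₙ (fun t : ℝ => min t δ) (a : A), cfcₙ_nonneg fun t ht =>
    le_min (quasispectrum_nonneg_of_nonneg _ a.2 t ht) hδ⟩

theorem cutDown_add_truncate (a : Pos A) {δ : ℝ} (hδ : 0 ≤ δ) :
    cutDown a δ + truncate a δ hδ = a := by
  apply Subtype.ext
  change cfcₙ (fun t : ℝ => max (t - δ) 0) (a : A) + cfcₙ (fun t : ℝ => min t δ) (a : A) = a
  rw [← cfcₙ_add (fun t : ℝ => max (t - δ) 0) (fun t : ℝ => min t δ) (a : A) (by fun_prop)
    (by simpa using hδ) (by fun_prop) (by simpa using hδ)]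
  conv_rhs => rw [← cfcₙ_id' ℝ (a : A) (.of_nonneg a.2)]
  congr 1
  funext t
  grind

theorem norm_truncate_le (a : Pos A) {δ : ℝ} (hδ : 0 ≤ δ) : ‖(truncate a δ hδ : A)‖ ≤ δ := by
  refine norm_cfcₙ_le fun t ht => ?_
  have ht0 : 0 ≤ t := quasispectrum_nonneg_of_nonneg _ a.2 t ht
  rw [Real.norm_eq_abs, abs_le]
  grind

theorem truncate_le (a : Pos A) {δ : ℝ} (hδ : 0 ≤ δ) : (truncate a δ hδ : A) ≤ a := by
  conv_rhs => rw [← cutDown_add_truncate a hδ]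
  exact le_add_of_nonneg_left (cutDown a δ).2

/-- Compression `x* b x` of a positive element. -/
def compress (x : A) (b : Pos A) : Pos A := ⟨star x * b * x, star_left_conjugate_nonneg b.2 x⟩

theorem compress_sq (x v : A) : compress x (sq v) = sq (v * x) := by
  apply Subtype.ext
  change star x * (star v * v) * x = star (v * x) * (v * x)
  rw [star_mul]
  noncomm_ring

theorem compress_add (x : A) (b c : Pos A) : compress x (b + c) = compress x b + compress x c := by
  apply Subtype.ext
  change star x * ((b : A) + c) * x = star x * b * x + star x * c * x
  noncomm_ring

theorem compress_compress (x y : A) (b : Pos A) :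
    compress x (compress y b) = compress (y * x) b := by
  apply Subtype.ext
  change star x * (star y * b * y) * x = star (y * x) * b * (y * x)
  rw [star_mul]
  noncomm_ring

theorem LscTrace.compress_le (τ : LscTrace A) (x : A) (b : Pos A) :
    τ (compress x b) ≤ (‖x‖₊ ^ 2 : ℝ≥0) * τ b := by
  obtain ⟨y, -, rfl⟩ := exists_sq_eq b
  rw [compress_sq]
  exact τ.sq_mul_right_le y x

/-- With `k = f(b)`, where `f` rises from `0` at `ε` to `1` at `2ε`, one has `(b - 2ε)₊ ≤ k (b - ε)
k ≤ k p k`, and compression preserves finiteness of the trace. -/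
theorem LscTrace.cutDown_lt_top_of_norm_sub_le (τ : LscTrace A) {b p : Pos A} {ε : ℝ} (hε : 0 < ε)
    (h : ‖(b : A) - p‖ ≤ ε) (hp : τ p < ⊤) : τ (cutDown b (2 * ε)) < ⊤ := by
  have hb : IsSelfAdjoint (b : A) := .of_nonneg b.2
  have hp' : IsSelfAdjoint (p : A) := .of_nonneg p.2
  set f : ℝ → ℝ := fun t => min 1 (max (t - ε) 0 / ε) with hf
  have hfc : Continuous f := by fun_prop
  have hf0 : f 0 = 0 := by simp [hf, hε.le]
  set k := cfcₙ f (b : A) with hk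
  have hks : star k = k := (isSelfAdjoint_cfcₙ f (b : A)).star_eq
  have h1 : k * (b - p) * k ≤ ε • (k * k) := by
    have := CStarAlgebra.star_left_conjugate_le_norm_smul (a := k) (b := (b : A) - p) (hb.sub hp')
    rw [hks] at this
    refine this.trans (smul_le_smul_of_nonneg_right h ?_)
    simpa [hks] using star_mul_self_nonneg k
  have h2 : (cutDown b (2 * ε) : A) ≤ k * b * k - ε • (k * k) := by
    rw [hk, cfcₙ_conj_self hb hfc hf0,
      ← cfcₙ_mul f f (b : A) hfc.continuousOn hf0 hfc.continuousOn hf0,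
      ← cfcₙ_smul ε (fun t => f t * f t) (b : A) (by fun_prop) (by simp [hf0]),
      ← cfcₙ_sub (fun t => f t * t * f t) _ (b : A) (by fun_prop) (by simp [hf0]) (by fun_prop)
        (by simp [hf0])]
    refine cfcₙ_mono (fun t _ => ?_) (by fun_prop) (by fun_prop) (by simp [hε.le])
      (by simp [hf0])
    have : f t * t * f t - ε • (f t * f t) = f t * f t * (t - ε) := by
      rw [smul_eq_mul]; ring
    rw [this]
    rcases le_total t ε with h | h
    · have : f t = 0 := by
        simp only [hf]
        rw [max_eq_right (by linarith), zero_div, min_eq_right zero_le_one]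
      rw [this, max_eq_right (by linarith)]
      simp
    · rcases le_total t (2 * ε) with h' | h'
      · rw [max_eq_right (by linarith)]
        exact mul_nonneg (mul_self_nonneg _) (by linarith)
      · have : f t = 1 := by
          simp only [hf]
          rw [min_eq_left]
          rw [le_div_iff₀ hε, one_mul]
          exact le_max_of_le_left (by linarith)
        rw [this, max_eq_left (by linarith)]
        linarith
  have h3 : (cutDown b (2 * ε) : A) ≤ compress k p := by
    refine h2.trans ?_
    change _ ≤ star k * p * k
    rw [hks, sub_le_iff_le_add]
    rw [mul_sub, sub_mul, sub_le_iff_le_add] at h1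
    rwa [add_comm] at h1
  exact (τ.mono h3).trans_lt
    ((τ.compress_le k p).trans_lt (ENNReal.mul_lt_top ENNReal.coe_lt_top hp))

theorem LscTrace.cutDown_lt_top_of_mem_finiteIdeal {τ : LscTrace A} {b : Pos A}
    (hb : (b : A) ∈ τ.finiteIdeal) {ε : ℝ} (hε : 0 < ε) : τ (cutDown b ε) < ⊤ := by
  obtain ⟨x, -, rfl⟩ := exists_sq_eq b
  have hx : x ∈ closure (τ.squareSummable : Set A) := τ.finiteIdeal.mem_of_sq_mem hb
  have hU : IsOpen {y : A | ‖(sq x : A) - sq y‖ < ε / 2} :=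
    isOpen_lt (continuous_const.sub (continuous_subtype_val.comp continuous_sq)).norm
      continuous_const
  obtain ⟨y, hy, hyN⟩ := mem_closure_iff.1 hx _ hU (by simpa using hε)
  have := τ.cutDown_lt_top_of_norm_sub_le (b := sq x) (p := sq y) (half_pos hε) (le_of_lt hy) hyN
  rwa [mul_div_cancel₀ _ two_ne_zero] at this

/-- If `c` is self-adjoint and `c* c ≤ s`, then `c* c` is a limit of elements `(g(s) c)* s (g(s) c)` with
`g(s) s g(s)` contractive. -/
theorem exists_compress_near {s : Pos A} {c : A} (hc : IsSelfAdjoint c) (h : (sq c : A) ≤ s)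
    {θ : ℝ} (hθ : 0 < θ) : ∃ x : A, ‖(compress x s : A)‖ ≤ ‖(sq c : A)‖ ∧
      ‖(compress x s : A) - sq c‖ ≤ θ := by
  have hs : IsSelfAdjoint (s : A) := .of_nonneg s.2
  -- Here `4η` bounds `t (1 - φ(t))²` on `t ≥ 0`, with `φ(t) = t² / (t + η)²` as below.
  obtain ⟨η, hη, hηθ⟩ : ∃ η : ℝ, 0 < η ∧ ‖c‖ * √(4 * η) ≤ θ := by
    have hlim : Filter.Tendsto (fun η : ℝ => ‖c‖ * √(4 * η)) (𝓝[>] 0) (𝓝 (‖c‖ * √(4 * 0))) :=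
      (Continuous.tendsto (by fun_prop) 0).mono_left nhdsWithin_le_nhds
    rw [mul_zero, Real.sqrt_zero, mul_zero] at hlim
    obtain ⟨η, h1, h2⟩ := ((hlim.eventually_le_const hθ).and self_mem_nhdsWithin).exists
    exact ⟨η, h2, h1⟩
  -- The absolute value only keeps the denominator nonzero on all of `ℝ`; the spectrum of `s` is
  -- nonnegative.
  set f : ℝ → ℝ := fun t => √t / (|t| + η) with hf
  have hden : ∀ t : ℝ, |t| + η ≠ 0 := fun t => by positivity
  have hfc : Continuous f := Continuous.div (by fun_prop) (by fun_prop) hden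
  have hf0 : f 0 = 0 := by simp [hf]
  set g := cfcₙ f (s : A) with hg
  have hgs : star g = g := (isSelfAdjoint_cfcₙ f (s : A)).star_eq
  set φ : ℝ → ℝ := fun t => f t * t * f t with hφ
  have hφc : Continuous φ := by fun_prop
  have hφ0 : φ 0 = 0 := by simp [hφ]
  set k := cfcₙ φ (s : A) with hk
  have hks : star k = k := (isSelfAdjoint_cfcₙ φ (s : A)).star_eq
  have hgk : g * s * g = k := cfcₙ_conj_self hs hfc hf0
  have hφt : ∀ t : ℝ, 0 ≤ t → φ t = t ^ 2 / (t + η) ^ 2 := by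
    intro t ht
    have : √t * √t = t := Real.mul_self_sqrt ht
    simp only [hφ, hf, abs_of_nonneg ht]
    field_simp
    rw [Real.sq_sqrt ht]
    ring
  have hk1 : ‖k‖ ≤ 1 := by
    refine norm_cfcₙ_le fun t ht => ?_
    have ht0 : 0 ≤ t := quasispectrum_nonneg_of_nonneg _ s.2 t ht
    rw [hφt t ht0, Real.norm_of_nonneg (by positivity), div_le_one (by positivity)]
    gcongr
    linarith
  have hcomp : (compress (g * c) s : A) = c * k * c := by
    change star (g * c) * s * (g * c) = _
    rw [star_mul, hgs, hc.star_eq, ← hgk]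
    noncomm_ring
  have hcc : ‖(sq c : A)‖ = ‖c‖ * ‖c‖ := CStarRing.norm_star_mul_self
  have hconj : ∀ y : A, (y - k * y) * star (y - k * y) =
      y * star y - k * (y * star y) - y * star y * k + k * (y * star y) * k := by
    intro y
    rw [star_sub, star_mul, hks]
    noncomm_ring
  -- This is `c² ≤ s` conjugated by `1 - k`, multiplied out because `A` need not have a unit.
  have hle : (c - k * c) * star (c - k * c) ≤ s - k * s - s * k + k * s * k := by
    rw [hconj]
    obtain ⟨y, hy⟩ := CStarAlgebra.nonneg_iff_eq_mul_star_self.1 (sub_nonneg.2 h)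
    rw [sq_of_isSelfAdjoint hc] at hy
    have := mul_star_self_nonneg (y - k * y)
    rw [hconj, ← hy] at this
    rw [← sub_nonneg, hc.star_eq]
    convert this using 1
    noncomm_ring
  have hcfc : (s : A) - k * s - s * k + k * s * k =
      cfcₙ (fun t : ℝ => t - φ t * t - t * φ t + φ t * t * φ t) (s : A) := by
    rw [cfcₙ_add (fun t : ℝ => t - φ t * t - t * φ t) _ (s : A) (by fun_prop) (by simp)
        (by fun_prop) (by simp),
      cfcₙ_sub (fun t : ℝ => t - φ t * t) _ (s : A) (by fun_prop) (by simp) (by fun_prop) (by simp),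
      cfcₙ_sub (fun t : ℝ => t) _ (s : A) (by fun_prop) (by simp) (by fun_prop) (by simp),
      cfcₙ_mul φ (fun t : ℝ => t) (s : A) (by fun_prop) hφ0 (by fun_prop) (by simp),
      cfcₙ_mul (fun t : ℝ => t) φ (s : A) (by fun_prop) (by simp) (by fun_prop) hφ0,
      cfcₙ_id' ℝ (s : A) hs, cfcₙ_conj_self hs hφc hφ0]
  have hnorm : ‖c - k * c‖ ≤ √(4 * η) := by
    refine Real.le_sqrt_of_sq_le ?_
    rw [pow_two, ← CStarRing.norm_self_mul_star]
    refine (CStarAlgebra.norm_le_norm_of_nonneg_of_le (mul_star_self_nonneg _) hle).trans ?_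
    rw [hcfc]
    refine norm_cfcₙ_le fun t ht => ?_
    have ht0 : 0 ≤ t := quasispectrum_nonneg_of_nonneg _ s.2 t ht
    have : t - φ t * t - t * φ t + φ t * t * φ t =
        t * (η * (2 * t + η)) ^ 2 / ((t + η) ^ 2) ^ 2 := by
      rw [hφt t ht0]
      field_simp
      ring
    rw [this, Real.norm_of_nonneg (by positivity), div_le_iff₀ (by positivity)]
    calc t * (η * (2 * t + η)) ^ 2 ≤ (t + η) * (η * (2 * (t + η))) ^ 2 := by
          gcongr <;> linarith
      _ = 4 * η * (η * (t + η)) * (t + η) ^ 2 := by ring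
      _ ≤ 4 * η * ((t + η) * (t + η)) * (t + η) ^ 2 := by gcongr; linarith
      _ = _ := by ring
  refine ⟨g * c, ?_, ?_⟩
  · rw [hcomp, hcc]
    calc ‖c * k * c‖ ≤ ‖c‖ * ‖k‖ * ‖c‖ := norm_mul₃_le
      _ ≤ ‖c‖ * 1 * ‖c‖ := by gcongr
      _ = _ := by ring
  · have : (compress (g * c) s : A) - sq c = -(c * (c - k * c)) := by
      rw [hcomp, sq_of_isSelfAdjoint hc]
      noncomm_ring
    rw [this, norm_neg]
    calc ‖c * (c - k * c)‖ ≤ ‖c‖ * ‖c - k * c‖ := norm_mul_le _ _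
      _ ≤ ‖c‖ * √(4 * η) := by gcongr
      _ ≤ θ := hηθ

/-! ### Positive elements dominated by a cut-down -/

/-- The positive element `s` is dominated by the cut-downs of `a` if all its compressions have
trace bounded by their norm times the trace of some fixed cut-down of `a`. -/
def IsDominated (a s : Pos A) : Prop :=
  ∃ (C : ℝ≥0) (ε : ℝ), 0 < ε ∧ ∀ (σ : LscTrace A) (x : A),
    σ (compress x s) ≤ (C * ‖(compress x s : A)‖₊ : ℝ≥0) * σ (cutDown a ε)

theorem isDominated_zero (a : Pos A) : IsDominated a 0 := by
  refine ⟨0, 1, one_pos, fun σ x => ?_⟩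
  have : compress x (0 : Pos A) = 0 := Subtype.ext (by simp [compress])
  simp [this, σ.map_zero']

theorem IsDominated.add {a s t : Pos A} (hs : IsDominated a s) (ht : IsDominated a t) :
    IsDominated a (s + t) := by
  obtain ⟨C, ε, hε, hC⟩ := hs
  obtain ⟨D, δ, hδ, hD⟩ := ht
  refine ⟨C + D, min ε δ, lt_min hε hδ, fun σ x => ?_⟩
  rw [compress_add, σ.map_add', add_mul, ENNReal.coe_add, add_mul]
  gcongr
  · refine (hC σ x).trans ?_
    gcongr
    · exact CStarAlgebra.norm_le_norm_of_nonneg_of_le (compress x s).2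
        (le_add_of_nonneg_right (compress x t).2)
    · exact σ.mono (cutDown_le_cutDown a (lt_min hε hδ).le (min_le_left _ _))
  · refine (hD σ x).trans ?_
    gcongr
    · exact CStarAlgebra.norm_le_norm_of_nonneg_of_le (compress x t).2
        (le_add_of_nonneg_left (compress x s).2)
    · exact σ.mono (cutDown_le_cutDown a (lt_min hε hδ).le (min_le_right _ _))

theorem IsDominated.compress {a s : Pos A} (hs : IsDominated a s) (y : A) :
    IsDominated a (compress y s) := by
  obtain ⟨C, ε, hε, hC⟩ := hs
  refine ⟨C, ε, hε, fun σ x => ?_⟩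
  rw [compress_compress]
  exact hC σ _

theorem IsDominated.sq_mul {a : Pos A} {v : A} (hv : IsDominated a (sq v)) (y : A) :
    IsDominated a (sq (v * y)) := by
  rw [← compress_sq]
  exact hv.compress y

/-- The scalar is absorbed into the compressing element, so the same `C` and `ε` serve. -/
theorem IsDominated.sq_smul {a : Pos A} {v : A} (hv : IsDominated a (sq v)) (c : ℂ) :
    IsDominated a (sq (c • v)) := by
  obtain ⟨C, ε, hε, hC⟩ := hv
  refine ⟨C, ε, hε, fun σ x => ?_⟩
  have := hC σ (c • x)
  rw [compress_sq] at this ⊢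
  rwa [smul_mul_assoc, ← mul_smul_comm]

/-- Take `v = (a - ε)₊^{1/2}` and `e = h(a)` with `e v = v` and `e² ≤ (2/ε) (a - ε/2)₊`. The trace
identity replaces `x* v* v x` by `y = v x x* v*`, and `y = e y e ≤ ‖y‖ e²`. -/
theorem exists_sq_eq_cutDown (a : Pos A) {ε : ℝ} (hε : 0 < ε) :
    ∃ v : A, sq v = cutDown a ε ∧ IsDominated a (sq v) := by
  set f : ℝ → ℝ := fun t => √(max (t - ε) 0) with hf
  have hfc : Continuous f := by fun_prop
  have hf0 : f 0 = 0 := by simp [hf, hε.le]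
  set h : ℝ → ℝ := fun t => min 1 (2 / ε * max (t - ε / 2) 0) with hh
  have hhc : Continuous h := by fun_prop
  have hε2 : 0 ≤ ε / 2 := (half_pos hε).le
  have hh0 : h 0 = 0 := by simp [hh, hε2]
  set v := cfcₙ f (a : A) with hv
  set e := cfcₙ h (a : A) with he
  have hes : star e = e := (isSelfAdjoint_cfcₙ h (a : A)).star_eq
  have hev : e * v = v := by
    rw [he, hv, ← cfcₙ_mul h f (a : A) hhc.continuousOn hh0 hfc.continuousOn hf0]
    congr 1
    funext t
    rcases le_total t ε with ht | ht
    · have : f t = 0 := by simp [hf, ht]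
      rw [this, mul_zero]
    · have : h t = 1 := by
        simp only [hh]
        rw [min_eq_left]
        rw [max_eq_left (by linarith)]
        calc (1 : ℝ) = 2 / ε * (ε / 2) := by field_simp
          _ ≤ 2 / ε * (t - ε / 2) := by gcongr; linarith
      rw [this, one_mul]
  have hee : e * e ≤ (2 / ε) • (cutDown a (ε / 2) : A) := by
    change cfcₙ h (a : A) * cfcₙ h (a : A) ≤ (2 / ε) • cfcₙ (fun t : ℝ => max (t - ε / 2) 0) (a : A)
    rw [← cfcₙ_mul h h (a : A) hhc.continuousOn hh0 hhc.continuousOn hh0,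
      ← cfcₙ_smul (2 / ε) (fun t : ℝ => max (t - ε / 2) 0) (a : A) (by fun_prop)
        (by simp [hε2])]
    refine cfcₙ_mono (fun t _ => ?_) (by fun_prop) (by fun_prop) (by simp [hh0])
      (by simp [hε2])
    have h0 : 0 ≤ h t := le_min zero_le_one (by positivity)
    have h1 : h t ≤ 1 := min_le_left _ _
    have h2 : h t ≤ 2 / ε * max (t - ε / 2) 0 := min_le_right _ _
    rw [smul_eq_mul]
    nlinarith
  refine ⟨v, ?_, ⟨2 / ε, by positivity⟩, ε / 2, half_pos hε, fun σ x => ?_⟩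
  · apply Subtype.ext
    rw [sq_cfcₙ hfc hf0]
    change _ = cfcₙ (fun t : ℝ => max (t - ε) 0) (a : A)
    congr 1
    funext t
    exact Real.mul_self_sqrt (le_max_right _ _)
  · rw [compress_sq, ← σ.sq_star]
    refine σ.apply_le_of_le_smul _ ?_
    have h1 := CStarAlgebra.star_left_conjugate_le_norm_smul (a := e)
      (b := v * x * star (v * x)) (.mul_star_self _)
    rw [hes] at h1
    have h2 : e * (v * x * star (v * x)) * e = v * x * star (v * x) := by
      have h3 : e * (v * x) = v * x := by rw [← mul_assoc, hev]
      have h4 : star (v * x) * e = star (v * x) := by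
        conv_rhs => rw [← h3, star_mul, hes]
      rw [← mul_assoc, h3, mul_assoc, h4]
    rw [h2, CStarRing.norm_self_mul_star, ← CStarRing.norm_star_mul_self] at h1
    change star (star (v * x)) * star (v * x) ≤ (2 / ε * ‖star (v * x) * (v * x)‖) • _
    rw [star_star, mul_comm, mul_smul]
    exact h1.trans (smul_le_smul_of_nonneg_left hee (norm_nonneg _))

/-! ### A dense two-sided ideal of dominated products -/

/-- The span of all products `x* y` with `x* x` and `y* y` dominated by the cut-downs of `a`. -/
def dominatedSpan (a : Pos A) : Submodule ℂ A :=
  Submodule.span ℂ {z | ∃ x y : A, IsDominated a (sq x) ∧ IsDominated a (sq y) ∧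
    x ∈ ClosedIdeal.generatedBy (a : A) ∧ y ∈ ClosedIdeal.generatedBy (a : A) ∧ z = star x * y}

theorem dominatedSpan_le (a : Pos A) :
    dominatedSpan a ≤ (ClosedIdeal.generatedBy (a : A)).toSubmodule := by
  refine Submodule.span_le.2 ?_
  rintro z ⟨x, y, -, -, -, hy, rfl⟩
  exact ClosedIdeal.mul_mem_left _ _ hy

theorem mul_mem_dominatedSpan {a : Pos A} (z : A) {w : A} (hw : w ∈ dominatedSpan a) :
    z * w ∈ dominatedSpan a ∧ w * z ∈ dominatedSpan a := by
  induction hw using Submodule.span_induction with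
  | mem w hw =>
    obtain ⟨x, y, hx, hy, hx', hy', rfl⟩ := hw
    refine ⟨Submodule.subset_span ⟨x * star z, y, hx.sq_mul _, hy,
      ClosedIdeal.mul_mem_right _ _ hx', hy', ?_⟩, Submodule.subset_span ⟨x, y * z, hx,
        hy.sq_mul _, hx', ClosedIdeal.mul_mem_right _ _ hy', mul_assoc _ _ _⟩⟩
    rw [star_mul, star_star, mul_assoc]
  | zero => simp
  | add x y _ _ hx hy =>
    rw [mul_add, add_mul]
    exact ⟨add_mem hx.1 hy.1, add_mem hx.2 hy.2⟩
  | smul c x _ hx =>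
    rw [mul_smul_comm, smul_mul_assoc]
    exact ⟨Submodule.smul_mem _ _ hx.1, Submodule.smul_mem _ _ hx.2⟩

theorem cutDown_mem_dominatedSpan (a : Pos A) {ε : ℝ} (hε : 0 < ε) :
    (cutDown a ε : A) ∈ dominatedSpan a := by
  obtain ⟨v, hv, hd⟩ := exists_sq_eq_cutDown a hε
  have hvI : v ∈ ClosedIdeal.generatedBy (a : A) := by
    apply ClosedIdeal.mem_of_sq_mem
    rw [hv]
    exact ClosedIdeal.mem_of_le _ (cutDown a ε).2 (ClosedIdeal.mem_generatedBy _)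
      (cutDown_le a hε.le)
  rw [← hv]
  exact Submodule.subset_span ⟨v, v, hd, hd, hvI, hvI, rfl⟩

/-- The closure of the span is a closed ideal of `A`, and it contains `a` as the limit of its
cut-downs. -/
theorem generatedBy_subset_closure_dominatedSpan (a : Pos A) :
    ((ClosedIdeal.generatedBy (a : A)).toSubmodule : Set A) ⊆ closure (dominatedSpan a : Set A) := by
  let J : ClosedIdeal A :=
    { toSubmodule := (dominatedSpan a).topologicalClosure
      mul_mem_left' := fun x _ hy => map_mem_closure (continuous_const_mul x) hy fun _ hz =>
        (mul_mem_dominatedSpan x hz).1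
      mul_mem_right' := fun _ y hx => map_mem_closure (f := fun z => z * y)
        (continuous_mul_const y) hx fun _ hz => (mul_mem_dominatedSpan y hz).2
      isClosed' := (dominatedSpan a).isClosed_topologicalClosure }
  have haJ : (a : A) ∈ J := by
    refine Metric.mem_closure_iff.2 fun ε hε => ⟨cutDown a (ε / 2),
      cutDown_mem_dominatedSpan a (half_pos hε), ?_⟩
    rw [dist_eq_norm]
    exact (norm_sub_cutDown_le a (half_pos hε).le).trans_lt (half_lt_self hε)
  exact fun x hx => ClosedIdeal.generatedBy_le haJ hx

theorem pedersen_le_dominatedSpan (a : Pos A) :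
    (ClosedIdeal.generatedBy (a : A)).pedersen ≤ dominatedSpan a :=
  sInf_le ⟨dominatedSpan_le a, generatedBy_subset_closure_dominatedSpan a,
    fun _ _ _ hy => mul_mem_dominatedSpan _ hy⟩

/-- For a generator `x* y`, put `p = z̄ x` and expand `0 ≤ (p - y)* (p - y)`. The free scalar `z`
lets the induction pass through scalar multiples. -/
theorem exists_isDominated_of_mem_dominatedSpan {a : Pos A} {w : A} (hw : w ∈ dominatedSpan a)
    (z : ℂ) : ∃ s : Pos A, IsDominated a s ∧ z • w + star (z • w) ≤ s := by
  induction hw using Submodule.span_induction generalizing z with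
  | mem w hw =>
    obtain ⟨x, y, hx, hy, -, -, rfl⟩ := hw
    refine ⟨_, (hx.sq_smul (star z)).add hy, ?_⟩
    have h : z • (star x * y) = star (star z • x) * y := by
      rw [star_smul, star_star, smul_mul_assoc]
    rw [h]
    set p := star z • x
    change star p * y + star (star p * y) ≤ star p * p + star y * y
    have := star_mul_self_nonneg (p - y)
    rw [← sub_nonneg]
    convert this using 1
    rw [star_mul, star_star, star_sub]
    noncomm_ring
  | zero => exact ⟨0, isDominated_zero a, by simp⟩
  | add x y _ _ hx hy =>
    obtain ⟨s, hs, hxs⟩ := hx z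
    obtain ⟨t, ht, hyt⟩ := hy z
    refine ⟨s + t, hs.add ht, ?_⟩
    change _ ≤ (s : A) + t
    rw [smul_add, star_add, add_add_add_comm]
    exact add_le_add hxs hyt
  | smul c x _ hx =>
    rw [smul_smul]
    exact hx _

theorem exists_isDominated_of_mem_pedersen {a : Pos A}
    (ha : (a : A) ∈ (ClosedIdeal.generatedBy (a : A)).pedersen) :
    ∃ s : Pos A, IsDominated a s ∧ (a : A) ≤ s := by
  obtain ⟨s, hs, h⟩ := exists_isDominated_of_mem_dominatedSpan (pedersen_le_dominatedSpan a ha)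
    (1 / 2)
  refine ⟨s, hs, ?_⟩
  rw [star_smul, (IsSelfAdjoint.of_nonneg a.2).star_eq, ← add_smul] at h
  have h2 : (1 / 2 + star (1 / 2) : ℂ) = 1 := by
    simp
    norm_num
  rwa [h2, one_smul] at h

/-- If `a` belongs to the Pedersen ideal of the closed ideal it generates, then the trace of
`min(a, δ)` is bounded by a multiple of `δ` times the trace of a fixed cut-down of `a`. -/
theorem exists_truncate_le {a : Pos A}
    (ha : (a : A) ∈ (ClosedIdeal.generatedBy (a : A)).pedersen) :
    ∃ (C : ℝ≥0) (ε : ℝ), 0 < ε ∧ ∀ (δ : ℝ≥0) (σ : LscTrace A),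
      σ (truncate a δ δ.2) ≤ (C * δ : ℝ≥0) * σ (cutDown a ε) := by
  obtain ⟨s, ⟨C, ε, hε, hC⟩, has⟩ := exists_isDominated_of_mem_pedersen ha
  refine ⟨C, ε, hε, fun δ σ => ?_⟩
  obtain ⟨c, hc, hct⟩ := exists_sq_eq (truncate a δ δ.2)
  have hcs : (sq c : A) ≤ s := by
    rw [hct]
    exact (truncate_le a δ.2).trans has
  -- Compressions of `s` of norm at most `δ` lie in this sublevel set and approximate `min(a, δ)`;
  -- the set is closed by lower semicontinuity of `σ`.
  have hmem : sq c ∈ closure {b : Pos A | σ b ≤ (C * δ : ℝ≥0) * σ (cutDown a ε)} := by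
    refine Metric.mem_closure_iff.2 fun θ hθ => ?_
    obtain ⟨x, hx1, hx2⟩ := exists_compress_near hc hcs (half_pos hθ)
    refine ⟨compress x s, (hC σ x).trans ?_, ?_⟩
    · gcongr
      rw [hct] at hx1
      exact hx1.trans (norm_truncate_le a δ.2)
    · rw [dist_comm, Subtype.dist_eq, dist_eq_norm]
      exact hx2.trans_lt (half_lt_self hθ)
  rw [← hct]
  exact closure_minimal (fun _ h => h) (σ.lsc'.isClosed_preimage _) hmem

/-! ### Continuity and finiteness of the evaluation at `a` -/

theorem exists_apply_le_cutDown {a : Pos A}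
    (ha : (a : A) ∈ (ClosedIdeal.generatedBy (a : A)).pedersen) :
    ∃ (C : ℝ≥0) (ε : ℝ), 0 < ε ∧ ∀ (δ : ℝ≥0) (σ : LscTrace A), (δ : ℝ) ≤ ε →
      σ a ≤ (1 + C * δ : ℝ≥0) * σ (cutDown a δ) := by
  obtain ⟨C, ε, hε, hC⟩ := exists_truncate_le ha
  refine ⟨C, ε, hε, fun δ σ hδ => ?_⟩
  conv_lhs => rw [← cutDown_add_truncate a δ.2]
  rw [σ.map_add', ENNReal.coe_add, add_mul, ENNReal.coe_one, one_mul]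
  refine add_le_add le_rfl ((hC δ σ).trans ?_)
  gcongr
  exact σ.mono (cutDown_le_cutDown a δ.2 hδ)

theorem continuous_evalFunctional {a : Pos A}
    (ha : (a : A) ∈ (ClosedIdeal.generatedBy (a : A)).pedersen) :
    Continuous (evalFunctional a) := by
  refine continuous_iff_lower_upperSemicontinuous.2 ⟨(evalFunctional a).lsc', fun τ r hr => ?_⟩
  change τ a < r at hr
  obtain ⟨C, ε, hε, hC⟩ := exists_apply_le_cutDown ha
  obtain ⟨δ, hδ, hδε, hδr⟩ : ∃ δ : ℝ≥0, 0 < δ ∧ (δ : ℝ) ≤ ε ∧ (1 + C * δ : ℝ≥0) * τ a < r := by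
    have hlim : Filter.Tendsto (fun δ : ℝ≥0 => ((1 + C * δ : ℝ≥0) : ℝ≥0∞) * τ a) (𝓝[>] 0)
        (𝓝 (((1 + C * 0 : ℝ≥0) : ℝ≥0∞) * τ a)) := by
      refine ENNReal.Tendsto.mul_const ?_ (Or.inr hr.ne_top)
      exact (Continuous.tendsto (by fun_prop) 0).mono_left nhdsWithin_le_nhds
    rw [mul_zero, add_zero, ENNReal.coe_one, one_mul] at hlim
    have hle : ∀ᶠ δ : ℝ≥0 in 𝓝[>] 0, (δ : ℝ) ≤ ε :=
      (((NNReal.continuous_coe.tendsto 0).mono_left nhdsWithin_le_nhds).eventually_le_const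
        (by simpa using hε))
    obtain ⟨δ, ⟨h1, h2⟩, h3⟩ :=
      ((hle.and (hlim.eventually_lt_const hr)).and self_mem_nhdsWithin).exists
    exact ⟨δ, h3, h1, h2⟩
  set c : ℝ≥0∞ := ((1 + C * δ : ℝ≥0) : ℝ≥0∞) with hc
  have hc0 : c ≠ 0 := by
    rw [hc, Ne, ENNReal.coe_eq_zero]
    positivity
  have hct : c ≠ ⊤ := ENNReal.coe_ne_top
  -- On this neighbourhood `σ((a - δ)₊) < r / c`, because `θ < δ`, so the key estimate gives `σ(a) <
  -- r`.
  have hopen : IsOpen {σ : LscTrace A | ∃ θ : ℝ, 0 < θ ∧ θ < δ ∧ σ (cutDown a θ) < r / c} :=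
    TopologicalSpace.isOpen_generateFrom_of_mem (Or.inr ⟨a, δ, r / c, rfl⟩)
  have hmem : τ a < r / c := by
    rwa [ENNReal.lt_div_iff_mul_lt (Or.inl hc0) (Or.inl hct), mul_comm]
  have hδ' : (0 : ℝ) < δ := hδ
  filter_upwards [hopen.mem_nhds ⟨δ / 2, half_pos hδ', half_lt_self hδ',
    (τ.mono (cutDown_le a (half_pos hδ').le)).trans_lt hmem⟩] with σ hσ
  obtain ⟨θ, h0, h1, h2⟩ := hσ
  change σ a < r
  refine (hC δ σ hδε).trans_lt ?_
  rw [mul_comm, ← ENNReal.lt_div_iff_mul_lt (Or.inl hc0) (Or.inl hct)]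
  exact (σ.mono (cutDown_le_cutDown a h0.le h1.le)).trans_lt h2

theorem apply_lt_top_iff_mem_finiteIdeal {a : Pos A}
    (ha : (a : A) ∈ (ClosedIdeal.generatedBy (a : A)).pedersen) {τ : LscTrace A} :
    τ a < ⊤ ↔ (a : A) ∈ τ.finiteIdeal := by
  refine ⟨LscTrace.mem_finiteIdeal_of_lt_top, fun h => ?_⟩
  obtain ⟨C, ε, hε, hC⟩ := exists_apply_le_cutDown ha
  exact (hC ⟨ε, hε.le⟩ τ le_rfl).trans_lt
    (ENNReal.mul_lt_top ENNReal.coe_lt_top (LscTrace.cutDown_lt_top_of_mem_finiteIdeal h hε))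

/-! ### Scaling limits of traces and the support of a functional -/

/-- On `J` the cut-downs have finite trace, which scaling sends to `0`, even where `τ` itself is
infinite; off `J` the value `∞` is unaffected by scaling. -/
theorem LscTrace.tendsto_smul_idealTrace_finiteIdeal (τ : LscTrace A) :
    Filter.Tendsto (fun n : ℕ => ((n : ℝ≥0) + 1)⁻¹ • τ) Filter.atTop
      (𝓝 (idealTrace τ.finiteIdeal)) := by
  refine tendsto_interval_iff.2 fun b ε hε => ?_
  simp only [LscTrace.smul_apply]
  have hlim : Filter.Tendsto (fun n : ℕ => ((n : ℝ≥0) + 1)⁻¹) Filter.atTop (𝓝 0) := by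
    simpa using tendsto_one_div_add_atTop_nhds_zero_nat (𝕜 := ℝ≥0)
  by_cases hb : (b : A) ∈ τ.finiteIdeal
  · rw [idealTrace_of_mem hb]
    refine ⟨le_of_eq (Filter.Tendsto.limsup_eq ?_), zero_le⟩
    simpa using ENNReal.Tendsto.mul_const (ENNReal.tendsto_coe.2 hlim)
      (Or.inr (cutDown_lt_top_of_mem_finiteIdeal hb hε).ne)
  · rw [idealTrace_of_notMem hb]
    refine ⟨le_top, ?_⟩
    have hτ : τ b = ⊤ := not_lt_top_iff.1 fun h => hb (mem_finiteIdeal_of_lt_top h)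
    have (n : ℕ) : (((n : ℝ≥0) + 1)⁻¹ : ℝ≥0) * τ b = ⊤ := by
      rw [hτ, ENNReal.mul_top]
      exact ENNReal.coe_ne_zero.2 (by positivity)
    simp only [this, Filter.liminf_const, le_refl]

namespace LscFunctional

open Classical in
/-- The idempotent functional `∞ · g`. -/
def topMul (g : LscFunctional A) : LscFunctional A where
  toFun τ := if g τ = 0 then 0 else ⊤
  map_zero' := if_pos g.map_zero'
  map_add' σ τ := by
    by_cases h1 : g σ = 0 <;> by_cases h2 : g τ = 0 <;> simp [g.map_add', h1, h2]
  map_smul' r τ hr := by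
    by_cases h : g τ = 0
    · simp [g.map_smul' r τ hr, h]
    · simp [g.map_smul' r τ hr, h, hr.ne', ENNReal.mul_top]
  lsc' := by
    intro τ r hr
    dsimp only at hr
    split_ifs at hr with h
    · exact absurd hr not_lt_zero
    · filter_upwards [g.lsc' τ 0 (pos_iff_ne_zero.2 h)] with σ hσ
      simpa only [if_neg (ne_of_gt hσ)] using hr

theorem topMul_add_self (g : LscFunctional A) (τ : LscTrace A) :
    g.topMul τ + g.topMul τ = g.topMul τ := by
  by_cases h : g τ = 0 <;> simp [topMul, h]

theorem le_topMul (g : LscFunctional A) : g ≤ g.topMul := by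
  intro τ
  by_cases h : g τ = 0 <;> simp [topMul, h]

/-- The functional `∞ · g` is an idempotent above `g`, so it lies above `f_I`. -/
theorem HasSupportIdeal.le_idealTrace {g : LscFunctional A} {I : ClosedIdeal A}
    (hg : g.HasSupportIdeal I) {τ : LscTrace A} (h : g τ = 0) : τ ≤ idealTrace I := by
  have h1 : idealFunctional I τ ≤ g.topMul τ := hg.1 ⟨g.topMul_add_self, g.le_topMul⟩ τ
  have h2 : g.topMul τ = 0 := if_pos h
  by_contra hτ
  have h3 : idealFunctional I τ = ⊤ := if_neg hτ
  rw [h2, h3] at h1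
  simp at h1

/-- As a lower bound of the idempotents above it, `g` lies below their infimum `f_I`, which vanishes
at `τ_I`. -/
theorem HasSupportIdeal.apply_idealTrace {g : LscFunctional A} {I : ClosedIdeal A}
    (hg : g.HasSupportIdeal I) : g (idealTrace I) = 0 := by
  have h : g (idealTrace I) ≤ idealFunctional I (idealTrace I) := hg.2 (fun _ he => he.2) _
  rwa [show idealFunctional I (idealTrace I) = 0 from if_pos le_rfl, nonpos_iff_eq_zero] at h

theorem HasSupportIdeal.apply_eq_top {g : LscFunctional A} {I : ClosedIdeal A}
    (hg : g.HasSupportIdeal I) (hc : Continuous g) {τ : LscTrace A} {b : Pos A} (hb : (b : A) ∈ I)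
    (hτ : (b : A) ∉ τ.finiteIdeal) : g τ = ⊤ := by
  by_contra htop
  have h1 : Filter.Tendsto (fun n : ℕ => g (((n : ℝ≥0) + 1)⁻¹ • τ)) Filter.atTop
      (𝓝 (g (idealTrace τ.finiteIdeal))) :=
    (hc.tendsto _).comp τ.tendsto_smul_idealTrace_finiteIdeal
  have h2 : Filter.Tendsto (fun n : ℕ => g (((n : ℝ≥0) + 1)⁻¹ • τ)) Filter.atTop (𝓝 0) := by
    have hlim : Filter.Tendsto (fun n : ℕ => ((n : ℝ≥0) + 1)⁻¹) Filter.atTop (𝓝 0) := by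
      simpa using tendsto_one_div_add_atTop_nhds_zero_nat (𝕜 := ℝ≥0)
    have (n : ℕ) : g (((n : ℝ≥0) + 1)⁻¹ • τ) = (((n : ℝ≥0) + 1)⁻¹ : ℝ≥0) * g τ :=
      g.map_smul' _ _ (by positivity)
    simp only [this]
    simpa using ENNReal.Tendsto.mul_const (ENNReal.tendsto_coe.2 hlim) (Or.inr htop)
  have h3 := hg.le_idealTrace (tendsto_nhds_unique h1 h2)
  exact hτ (idealTrace_le_idealTrace_iff.1 h3 b hb)

end LscFunctional

/-- An idempotent `e ≥ ā` has values in `{0, ∞}` and can vanish only where `τ(a) = 0`, that is,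
where `τ ≤ τ_I`. Conversely, `f_I` is itself such an idempotent. -/
theorem hasSupportIdeal_evalFunctional (a : Pos A) :
    (evalFunctional a).HasSupportIdeal (ClosedIdeal.generatedBy (a : A)) := by
  refine ⟨?_, fun f hf => hf ⟨fun τ => ?_, fun τ => ?_⟩⟩
  · rintro e ⟨he, hae⟩ τ
    by_cases h : τ ≤ idealTrace (ClosedIdeal.generatedBy (a : A))
    · rw [show idealFunctional _ τ = 0 from if_pos h]
      exact zero_le
    · have h0 : e τ ≠ 0 := fun h0 => h (LscTrace.le_idealTrace_generatedBy_iff.2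
        (nonpos_iff_eq_zero.1 (h0 ▸ hae τ)))
      have : e τ = ⊤ := by
        by_contra ht
        exact h0 (LscTrace.eq_zero_of_add_self_eq (he τ) (lt_top_iff_ne_top.2 ht))
      rw [this]
      exact le_top
  · by_cases h : τ ≤ idealTrace (ClosedIdeal.generatedBy (a : A)) <;>
      simp [idealFunctional, h]
  · by_cases h : τ ≤ idealTrace (ClosedIdeal.generatedBy (a : A))
    · exact (LscTrace.le_idealTrace_generatedBy_iff.1 h).trans_le zero_le
    · rw [show idealFunctional _ τ = ⊤ from if_neg h]
      exact le_top

/-- Adding `τ_I` to a trace that is finite at a generator of `I` gives a trace in `T_I(A)`. -/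
theorem add_idealTrace_mem_supportCone {a : Pos A} {τ : LscTrace A} (h : τ a < ⊤) :
    τ + idealTrace (ClosedIdeal.generatedBy (a : A)) ∈
      supportCone (ClosedIdeal.generatedBy (a : A)) := by
  set I := ClosedIdeal.generatedBy (a : A) with hI
  have hfin : (τ + idealTrace I) a < ⊤ := by
    rw [LscTrace.add_apply, idealTrace_of_mem (ClosedIdeal.mem_generatedBy _), add_zero]
    exact h
  -- Finiteness at `a` puts `I` inside the finite ideal `J` of `τ + τ_I`. The reverse inclusion
  -- holds because `τ_I` is an idempotent below `τ + τ_I`, hence below `τ_J`.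
  refine LscTrace.mem_supportCone_iff.2 (ClosedIdeal.ext_of_forall_nonneg fun b => ⟨fun hb =>
    ClosedIdeal.generatedBy_le (LscTrace.mem_finiteIdeal_of_lt_top hfin) hb, fun hb => ?_⟩)
  refine idealTrace_le_idealTrace_iff.1 (LscTrace.isLUB_idealTrace_finiteIdeal _ |>.1
    ⟨idealTrace_add_self I, fun c => ?_⟩) b hb
  rw [LscTrace.add_apply]
  exact le_add_self

end TraceCone

end

theorem mainTheorem10 {A : Type*} [NonUnitalCStarAlgebra A] [PartialOrder A] [StarOrderedRing A]
    (a : Pos A) (I : ClosedIdeal A) (hI : I = ClosedIdeal.generatedBy (a : A))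
    (ha : (a : A) ∈ I.pedersen) :
    -- the restriction of `ā` to `T_I(A)` is continuous, finite, and vanishes only at `τ_I`
    Continuous (fun τ : supportCone I => evalFunctional a τ) ∧
    (∀ τ : supportCone I, evalFunctional a τ < ⊤) ∧
    (fun τ : supportCone I => evalFunctional a τ) ⁻¹' {0} =
      {⟨idealTrace I, idealTrace_mem_supportCone I⟩} ∧
    -- its canonical extension to `T(A)` coincides with `ā`
    (∀ τ : LscTrace A, extend I (fun σ : supportCone I => evalFunctional a σ) τ =
      evalFunctional a τ) ∧
    -- `ā` is the unique extension to a continuous cone morphism on `T(A)` with support ideal `I`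
    Continuous (evalFunctional a) ∧
    (evalFunctional a).HasSupportIdeal I ∧
    ∀ g : LscFunctional A, Continuous g → g.HasSupportIdeal I →
      (∀ τ : supportCone I, g τ = evalFunctional a τ) → g = evalFunctional a := by
  subst hI
  have hpos : ∀ τ : supportCone (ClosedIdeal.generatedBy (a : A)), evalFunctional a τ < ⊤ := by
    rintro ⟨τ, hτ⟩
    refine (apply_lt_top_iff_mem_finiteIdeal ha).2 ?_
    rw [← LscTrace.mem_supportCone_iff.1 hτ]
    exact ClosedIdeal.mem_generatedBy _
  have hcont := continuous_evalFunctional ha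
  refine ⟨hcont.comp continuous_subtype_val, hpos, ?_, fun τ => ?_, hcont,
    hasSupportIdeal_evalFunctional a, fun g hg hgI hga => ?_⟩
  · ext ⟨τ, hτ⟩
    rw [Set.mem_singleton_iff, Subtype.mk.injEq]
    refine Iff.trans (b := τ a = 0) Iff.rfl ?_
    rw [← LscTrace.le_idealTrace_generatedBy_iff]
    refine ⟨fun h => le_antisymm h ?_, fun h => h.le⟩
    -- Members of `T_I(A)` dominate their support idempotent `τ_I`, so vanishing at `a` forces
    -- equality.
    conv_lhs => rw [LscTrace.mem_supportCone_iff.1 hτ]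
    exact τ.idealTrace_finiteIdeal_le
  · have heval : (τ + idealTrace (ClosedIdeal.generatedBy (a : A))) a = τ a := by
      rw [LscTrace.add_apply, idealTrace_of_mem (ClosedIdeal.mem_generatedBy _), add_zero]
    unfold extend
    split_ifs with h
    · exact heval
    · exact (not_lt_top_iff.1 fun ht => h (add_idealTrace_mem_supportCone ht)).symm
  · ext τ
    by_cases h : τ a < ⊤
    · have h1 := hga ⟨_, add_idealTrace_mem_supportCone h⟩
      change g (τ + idealTrace (ClosedIdeal.generatedBy (a : A))) =
        (τ + idealTrace (ClosedIdeal.generatedBy (a : A)) : LscTrace A) a at h1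
      rw [g.map_add', hgI.apply_idealTrace, add_zero, LscTrace.add_apply,
        idealTrace_of_mem (ClosedIdeal.mem_generatedBy _), add_zero] at h1
      exact h1
    · rw [hgI.apply_eq_top hg (ClosedIdeal.mem_generatedBy _)
        fun hJ => h ((apply_lt_top_iff_mem_finiteIdeal ha).2 hJ)]
      exact (not_lt_top_iff.1 h).symm
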